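/- Let $p\in[1,\infty)$ and let $(X,d)$, $(Y,\partial)$ be uniformly locally finite metric spaces, i.e. $\sup_{x\in X}|\{x'\in X : d(x,x')\le n\}|<\infty$ for every $n\in\mathbb N$, and likewise for $Y$. An operator $T\in\mathcal B(\ell_p(X))$ (complex scalars) has finite propagation if there is $n\in\mathbb N$ such that $(T\delta_x)(y)\neq 0$ implies $d(x,y)\le n$ for all $x,y\in X$. The $\ell_p$ uniform Roe algebra $\mathrm B^p_u(X)$ is the operator-norm closure in $\mathcal B(\ell_p(X))$ of the algebra of operators of finite propagation. An operator $a\in \mathrm B^p_u(X)$ is a ghost if for every $\varepsilon>0$ there is a finite $A\subset X$ such that $\|e_{yy}\,a\,e_{xx}\|<\varepsilon$ for all $x,y\in X\setminus A$, where $e_{xx}\xi=\xi(x)\delta_x$. The same definitions apply to $Y$. Assume that every ghost idempotent in $\mathrm B^p_u(X)$ and every ghost idempotent in $\mathrm B^p_u(Y)$ is a compact operator. If $\mathrm B^p_u(X)$ and $\mathrm B^p_u(Y)$ are isomorphic as Banach algebras, i.e. if there is a $\mathbb C$-linear multiplicative bijection $\mathrm B^p_u(X)\to \mathrm B^p_u(Y)$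 which is bounded with bounded inverse (not necessarily isometric), then $X$ and $Y$ are coarsely equivalent: there are maps $f\colon X\to Y$ and $g\colon Y\to X$ such that $\sup_{x\in X}d(g(f(x)),x)<\infty$, $\sup_{y\in Y}\partial(f(g(y)),y)<\infty$, and both maps are coarse, i.e. for every $r>0$ there is $s>0$ such that $d(x,x')<r$ implies $\partial(f(x),f(x'))<s$, and $\partial(y,y')<r$ implies $d(g(y),g(y'))<s$. -/

import Mathlib

open scoped ENNReal

/-! ### Large-scale geometry of metric spaces -/

/-- `X` is uniformly locally finite: for every `n`, the cardinalities of the closed balls of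
radius `n` are bounded by a natural number that does not depend on the centre. -/
def UniformlyLocallyFinite (X : Type*) [MetricSpace X] : Prop :=
  ∀ n : ℕ, ∃ N : ℕ, ∀ x : X, {y : X | dist x y ≤ n}.encard ≤ N

/-- Coarse maps between metric spaces. -/
def IsCoarseMap {X Y : Type*} [MetricSpace X] [MetricSpace Y] (f : X → Y) : Prop :=
  ∀ r : ℝ, 0 < r → ∃ s : ℝ, 0 < s ∧ ∀ x y : X, dist x y < r → dist (f x) (f y) < s

/-- Two maps into a metric space are close if they are at finite uniform distance. -/
def AreClose {X Y : Type*} [MetricSpace Y] (f g : X → Y) : Prop :=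
  ∃ C : ℝ, ∀ x : X, dist (f x) (g x) ≤ C

/-- Coarse equivalence of metric spaces. -/
def CoarselyEquivalent (X Y : Type*) [MetricSpace X] [MetricSpace Y] : Prop :=
  ∃ (f : X → Y) (g : Y → X), IsCoarseMap f ∧ IsCoarseMap g ∧
    AreClose (g ∘ f) id ∧ AreClose (f ∘ g) id

/-! ### Operators on `ℓ_p(X)` -/

/-- The complex Banach space `ℓ_p(X)`. -/
abbrev EllP (p : ℝ≥0∞) (X : Type*) : Type _ := lp (fun _ : X => ℂ) p

section Operators

variable (p : ℝ≥0∞) {X : Type*}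

open Classical in
/-- The canonical unit vector `δ_x` of `ℓ_p(X)`. -/
noncomputable def delta (x : X) : EllP p X := lp.single p x (1 : ℂ)

variable {p}

theorem delta_apply_self (x : X) : (delta p x : X → ℂ) x = 1 := by
  simp [delta]

theorem delta_apply_ne {x y : X} (h : y ≠ x) : (delta p x : X → ℂ) y = 0 := by
  simp [delta, h]

open Classical in
theorem single_eq_smul_delta (x : X) (c : ℂ) :
    (lp.single p x c : EllP p X) = c • delta p x := by
  ext y
  by_cases h : y = x
  · subst h
    simp [delta]
  · simp [delta, h]

variable (p) [Fact (1 ≤ p)]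

/-- The operator `e_{xy}` on `ℓ_p(X)`, `ξ ↦ ξ(x) δ_y`. -/
noncomputable def matrixUnit (x y : X) : EllP p X →L[ℂ] EllP p X :=
  (lp.evalCLM ℂ (fun _ : X => ℂ) p x).smulRight (delta p y)

variable {p}

theorem norm_delta (x : X) : ‖delta p x‖ = 1 := by
  classical
  have h : (0 : ℝ≥0∞) < p := zero_lt_one.trans_le Fact.out
  simp [delta, lp.norm_single h]

theorem matrixUnit_apply (x y : X) (ξ : EllP p X) : matrixUnit p x y ξ = ξ x • delta p y := rfl

/-- `e_{xy} δ_z` is `δ_y` if `x = z`. -/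
theorem matrixUnit_delta_self (x y : X) : matrixUnit p x y (delta p x) = delta p y := by
  rw [matrixUnit_apply, delta_apply_self, one_smul]

/-- `e_{xy} δ_z` is `0` if `x ≠ z`. -/
theorem matrixUnit_delta_ne {x y z : X} (h : x ≠ z) : matrixUnit p x y (delta p z) = 0 := by
  rw [matrixUnit_apply, delta_apply_ne h, zero_smul]

/-- The norm of the corner `e_{yy} a e_{xx}` is the modulus of the matrix entry `(a δ_x)(y)`. -/
theorem norm_corner (a : EllP p X →L[ℂ] EllP p X) (x y : X) :
    ‖matrixUnit p y y * a * matrixUnit p x x‖ = ‖(a (delta p x) : X → ℂ) y‖ := by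
  have key : ∀ ξ : EllP p X, (matrixUnit p y y * a * matrixUnit p x x) ξ =
      (ξ x * (a (delta p x) : X → ℂ) y) • delta p y := by
    intro ξ
    simp [matrixUnit_apply, mul_smul]
  have hp0 : p ≠ 0 := (zero_lt_one.trans_le (Fact.out : 1 ≤ p)).ne'
  refine le_antisymm (ContinuousLinearMap.opNorm_le_bound _ (norm_nonneg _) fun ξ => ?_) ?_
  · rw [key, norm_smul, norm_delta, mul_one, norm_mul, mul_comm]
    exact mul_le_mul_of_nonneg_left (lp.norm_apply_le_norm hp0 ξ x) (norm_nonneg _)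
  · have h := ContinuousLinearMap.le_opNorm (matrixUnit p y y * a * matrixUnit p x x) (delta p x)
    rwa [key, delta_apply_self, one_mul, norm_smul, norm_delta, norm_delta, mul_one, mul_one] at h

end Operators

/-! ### Uniform Roe algebras -/

section Roe

variable {p : ℝ≥0∞} [Fact (1 ≤ p)] {X : Type*} [MetricSpace X]

/-- The operator `T` on `ℓ_p(X)` has propagation at most `n`. -/
def HasPropagationLE (T : EllP p X →L[ℂ] EllP p X) (n : ℕ) : Prop :=
  ∀ x y : X, (T (delta p x) : X → ℂ) y ≠ 0 → dist x y ≤ n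

theorem HasPropagationLE.mono {T : EllP p X →L[ℂ] EllP p X} {m n : ℕ}
    (h : HasPropagationLE T m) (hmn : m ≤ n) : HasPropagationLE T n := fun x y hxy =>
  (h x y hxy).trans (by exact_mod_cast hmn)

theorem HasPropagationLE.add {S T : EllP p X →L[ℂ] EllP p X} {m n : ℕ}
    (hS : HasPropagationLE S m) (hT : HasPropagationLE T n) :
    HasPropagationLE (S + T) (max m n) := by
  intro x y hxy
  by_cases h : (S (delta p x) : X → ℂ) y = 0
  · refine hT.mono (le_max_right m n) x y fun h' => hxy ?_
    simp [h, h']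
  · exact hS.mono (le_max_left m n) x y h

theorem HasPropagationLE.mul (hp : p ≠ ∞) {S T : EllP p X →L[ℂ] EllP p X} {m n : ℕ}
    (hS : HasPropagationLE S m) (hT : HasPropagationLE T n) :
    HasPropagationLE (S * T) (n + m) := by
  classical
  intro x y hxy
  by_contra hd
  refine hxy ?_
  have h1 : HasSum (fun z : X => lp.single p z ((T (delta p x) : X → ℂ) z)) (T (delta p x)) :=
    lp.hasSum_single hp (T (delta p x))
  have h2 := h1.mapL ((lp.evalCLM ℂ (fun _ : X => ℂ) p y).comp S)
  have h3 : ∀ z : X, ((lp.evalCLM ℂ (fun _ : X => ℂ) p y).comp S)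
      (lp.single p z ((T (delta p x) : X → ℂ) z)) = 0 := by
    intro z
    rw [single_eq_smul_delta, map_smul, smul_eq_mul, mul_eq_zero]
    by_contra! hne
    refine hd ?_
    have hSz := hS z y hne.2
    have hTz := hT x z hne.1
    push_cast
    exact (dist_triangle x z y).trans (add_le_add hTz hSz)
  simp only [h3] at h2
  exact h2.unique hasSum_zero

theorem hasPropagationLE_algebraMap (c : ℂ) :
    HasPropagationLE (algebraMap ℂ (EllP p X →L[ℂ] EllP p X) c) 0 := by
  intro x y hxy
  have h : y = x := by
    by_contra hne
    refine hxy ?_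
    simp [Algebra.algebraMap_eq_smul_one, delta_apply_ne hne]
  simp [h]

variable (p X)

/-- The algebra of the operators of finite propagation on `ℓ_p(X)`, `1 ≤ p < ∞`. -/
noncomputable def finitePropagationAlgebra (hp : p ≠ ∞) : Subalgebra ℂ (EllP p X →L[ℂ] EllP p X) where
  carrier := {T | ∃ n : ℕ, HasPropagationLE T n}
  mul_mem' := fun ⟨_, hS⟩ ⟨_, hT⟩ => ⟨_, hS.mul hp hT⟩
  add_mem' := fun ⟨_, hS⟩ ⟨_, hT⟩ => ⟨_, hS.add hT⟩
  algebraMap_mem' := fun c => ⟨0, hasPropagationLE_algebraMap c⟩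

/-- The `ℓ_p` uniform Roe algebra of `X`, `1 ≤ p < ∞`: the closure, in the operator norm, of the
algebra of the operators of finite propagation. -/
noncomputable def uniformRoeAlgebra (hp : p ≠ ∞) : Subalgebra ℂ (EllP p X →L[ℂ] EllP p X) :=
  (finitePropagationAlgebra p X hp).topologicalClosure

variable {p X}

/-- The ghost condition for an operator on `ℓ_p(X)`. -/
def IsGhost (a : EllP p X →L[ℂ] EllP p X) : Prop :=
  ∀ ε : ℝ, 0 < ε → ∃ A : Finset X, ∀ x y : X, x ∉ A → y ∉ A →
    ‖matrixUnit p y y * a * matrixUnit p x x‖ < ε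

variable (p X)

/-- Every ghost idempotent in the `ℓ_p` uniform Roe algebra of `X` is a compact operator. -/
def GhostIdempotentsCompact (hp : p ≠ ∞) : Prop :=
  ∀ P : EllP p X →L[ℂ] EllP p X, P ∈ uniformRoeAlgebra p X hp →
    IsIdempotentElem P → IsGhost P → IsCompactOperator P

end Roe

section RankOne

theorem exists_apply_ne_zero {p : ℝ≥0∞} {X : Type*} {ξ : EllP p X} (h : ξ ≠ 0) : ∃ x, ξ x ≠ 0 := by
  by_contra! h'
  exact h (lp.ext (funext h'))

variable {p : ℝ≥0∞} [Fact (1 ≤ p)] {X : Type*}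

/-- The rank one operator `η ↦ η(x) ξ`. -/
noncomputable def rankOne (x : X) (ξ : EllP p X) : EllP p X →L[ℂ] EllP p X :=
  (lp.evalCLM ℂ (fun _ : X => ℂ) p x).smulRight ξ

theorem rankOne_apply (x : X) (ξ η : EllP p X) : rankOne x ξ η = η x • ξ := rfl

theorem rankOne_apply_delta (x : X) (ξ : EllP p X) : rankOne x ξ (delta p x) = ξ := by
  rw [rankOne_apply, delta_apply_self, one_smul]

theorem continuous_rankOne (x : X) : Continuous (rankOne (p := p) x) :=
  (ContinuousLinearMap.smulRightL ℂ (EllP p X) (EllP p X)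
    (lp.evalCLM ℂ (fun _ : X => ℂ) p x)).continuous

theorem norm_apply_le (ξ : EllP p X) (x : X) : ‖ξ x‖ ≤ ‖ξ‖ :=
  lp.norm_apply_le_norm (zero_lt_one.trans_le (Fact.out : 1 ≤ p)).ne' ξ x

theorem hasSum_smul_delta (hp : p ≠ ∞) (ξ : EllP p X) :
    HasSum (fun x => ξ x • delta p x) ξ := by
  classical
  simpa only [single_eq_smul_delta] using lp.hasSum_single hp ξ

theorem exists_apply_delta_ne_zero (hp : p ≠ ∞) {T : EllP p X →L[ℂ] EllP p X} (h : T ≠ 0) :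
    ∃ x, T (delta p x) ≠ 0 := by
  by_contra! h'
  refine h (ContinuousLinearMap.ext fun ξ => ?_)
  have := (hasSum_smul_delta hp ξ).mapL T
  simp only [map_smul, h', smul_zero] at this
  exact this.unique hasSum_zero

/-- Elements of `ℓ_p(X)`, `p < ∞`, vanish at infinity. -/
theorem finite_setOf_le_norm_apply (hp : p ≠ ∞) (ξ : EllP p X) {ε : ℝ} (hε : 0 < ε) :
    {x | ε ≤ ‖ξ x‖}.Finite := by
  have h := (hasSum_smul_delta hp ξ).summable.tendsto_cofinite_zero.norm
  simp only [norm_smul, norm_delta, mul_one, norm_zero] at h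
  have := h.eventually (gt_mem_nhds hε)
  simpa [Filter.eventually_cofinite] using this

end RankOne

section RoeAlgebra

variable {p : ℝ≥0∞} [Fact (1 ≤ p)] {X : Type*} [MetricSpace X]

theorem HasPropagationLE.mem_uniformRoeAlgebra (hp : p ≠ ∞) {T : EllP p X →L[ℂ] EllP p X} {n : ℕ}
    (h : HasPropagationLE T n) : T ∈ uniformRoeAlgebra p X hp :=
  Subalgebra.le_topologicalClosure _ ⟨n, h⟩

/-- The uniform Roe algebra contains the matrix units. -/
theorem matrixUnit_mem_uniformRoeAlgebra (hp : p ≠ ∞) (x y : X) :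
    matrixUnit p x y ∈ uniformRoeAlgebra p X hp := by
  refine HasPropagationLE.mem_uniformRoeAlgebra (n := ⌈dist x y⌉₊) hp fun z w h => ?_
  by_cases hz : x = z
  · subst hz
    by_cases hw : w = y
    · subst hw
      exact Nat.le_ceil _
    · rw [matrixUnit_delta_self, delta_apply_ne hw] at h
      exact absurd rfl h
  · rw [matrixUnit_delta_ne hz] at h
    exact absurd rfl h

theorem rankOne_mem_uniformRoeAlgebra (hp : p ≠ ∞) (x : X) (ξ : EllP p X) :
    rankOne x ξ ∈ uniformRoeAlgebra p X hp := by
  have h := (hasSum_smul_delta hp ξ).mapL (ContinuousLinearMap.smulRightL ℂ (EllP p X) (EllP p X)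
    (lp.evalCLM ℂ (fun _ : X => ℂ) p x))
  refine (Subalgebra.isClosed_topologicalClosure (finitePropagationAlgebra p X hp)).mem_of_tendsto
    h (Filter.Eventually.of_forall fun s => ?_)
  refine Subalgebra.sum_mem _ fun y _ => ?_
  rw [map_smul]
  exact Subalgebra.smul_mem _ (matrixUnit_mem_uniformRoeAlgebra hp x y) _

/-- The matrix entries of an operator in the uniform Roe algebra vanish uniformly far away from
the diagonal. -/
theorem exists_dist_le_of_le_norm_apply_delta {hp : p ≠ ∞} {T : EllP p X →L[ℂ] EllP p X}
    (hT : T ∈ uniformRoeAlgebra p X hp) {ε : ℝ} (hε : 0 < ε) :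
    ∃ n : ℕ, ∀ x y : X, ε ≤ ‖T (delta p x) y‖ → dist x y ≤ n := by
  obtain ⟨S, ⟨n, hS⟩, hd⟩ := Metric.mem_closure_iff.1 hT ε hε
  refine ⟨n, fun x y h => hS x y fun h0 => ?_⟩
  have h1 : ‖(T - S) (delta p x) y‖ ≤ ‖T - S‖ :=
    (norm_apply_le _ y).trans (((T - S).le_opNorm _).trans (by rw [norm_delta, mul_one]))
  have h2 : (T - S) (delta p x) y = T (delta p x) y := by
    simp [h0]
  rw [h2, ← dist_eq_norm] at h1
  linarith

end RoeAlgebra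

section PartialTranslation

variable {p : ℝ≥0∞} [Fact (1 ≤ p)] {X : Type*}

theorem toReal_pos_of_ne_top (hp : p ≠ ∞) : 0 < p.toReal :=
  ENNReal.toReal_pos (zero_lt_one.trans_le (Fact.out : 1 ≤ p)).ne' hp

theorem norm_extend_rpow {u v : ℕ → X} (hv : v.Injective) (hp : p ≠ ∞) (ξ : X → ℂ) :
    (fun y => ‖Function.extend v (ξ ∘ u) 0 y‖ ^ p.toReal) =
      Function.extend v (fun n => ‖ξ (u n)‖ ^ p.toReal) 0 := by
  funext y
  by_cases h : ∃ n, v n = y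
  · obtain ⟨n, rfl⟩ := h
    simp [hv.extend_apply]
  · simp [Function.extend_apply' _ _ _ h, Real.zero_rpow (toReal_pos_of_ne_top hp).ne']

theorem summable_norm_rpow (hp : p ≠ ∞) (ξ : EllP p X) :
    Summable fun x => ‖ξ x‖ ^ p.toReal :=
  (lp.memℓp ξ).summable (toReal_pos_of_ne_top hp)

/-- The partial translation on `ℓ_p(X)` that sends `δ_{u n}` to `δ_{v n}`, and the `δ_x` with `x`
outside of the range of `u` to `0`. -/
noncomputable def partialTranslation (hp : p ≠ ∞) {u v : ℕ → X} (hu : u.Injective)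
    (hv : v.Injective) : EllP p X →L[ℂ] EllP p X :=
  LinearMap.mkContinuous
    { toFun := fun ξ => ⟨Function.extend v ((ξ : X → ℂ) ∘ u) 0, memℓp_gen (by
        rw [norm_extend_rpow hv hp, summable_extend_zero hv]
        exact (summable_norm_rpow hp ξ).comp_injective hu)⟩
      map_add' := fun ξ η => by
        ext y
        change Function.extend v (fun n => ξ (u n) + η (u n)) 0 y =
          Function.extend v ((ξ : X → ℂ) ∘ u) 0 y + Function.extend v ((η : X → ℂ) ∘ u) 0 y
        by_cases h : ∃ n, v n = y
        · obtain ⟨n, rfl⟩ := h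
          simp [hv.extend_apply]
        · simp [Function.extend_apply' _ _ _ h]
      map_smul' := fun c ξ => by
        ext y
        by_cases h : ∃ n, v n = y
        · obtain ⟨n, rfl⟩ := h
          simp [hv.extend_apply]
        · simp [Function.extend_apply' _ _ _ h] }
    1 fun ξ => by
      rw [one_mul]
      refine lp.norm_le_of_tsum_le (toReal_pos_of_ne_top hp) (norm_nonneg _) ?_
      rw [lp.norm_rpow_eq_tsum (toReal_pos_of_ne_top hp)]
      simp only [LinearMap.coe_mk, AddHom.coe_mk]
      rw [norm_extend_rpow hv hp, tsum_extend_zero hv]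
      exact tsum_comp_le_tsum_of_inj (summable_norm_rpow hp ξ) (fun _ => by positivity) hu

variable (hp : p ≠ ∞) {u v : ℕ → X} (hu : u.Injective) (hv : v.Injective)

theorem partialTranslation_apply (ξ : EllP p X) (n : ℕ) :
    partialTranslation hp hu hv ξ (v n) = ξ (u n) :=
  hv.extend_apply _ _ n

theorem partialTranslation_apply_of_notMem_range (ξ : EllP p X) {y : X} (hy : y ∉ Set.range v) :
    partialTranslation hp hu hv ξ y = 0 :=
  Function.extend_apply' _ _ _ hy

theorem hasSum_partialTranslation (ξ : EllP p X) :
    HasSum (fun n => ξ (u n) • delta p (v n)) (partialTranslation hp hu hv ξ) := by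
  have h := hasSum_smul_delta hp (partialTranslation hp hu hv ξ)
  rw [← hv.hasSum_iff fun y hy => by
    rw [partialTranslation_apply_of_notMem_range hp hu hv ξ hy, zero_smul]] at h
  simpa only [Function.comp_def, partialTranslation_apply] using h

theorem partialTranslation_apply_delta (n : ℕ) :
    partialTranslation hp hu hv (delta p (u n)) = delta p (v n) := by
  refine (hasSum_partialTranslation hp hu hv _).unique ?_
  convert hasSum_single n fun m hm => ?_ using 1
  · rw [delta_apply_self, one_smul]
  · rw [delta_apply_ne (hu.ne hm), zero_smul]

theorem isIdempotentElem_partialTranslation :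
    IsIdempotentElem (partialTranslation (p := p) hp hu hu) := by
  refine ContinuousLinearMap.ext fun ξ => lp.ext (funext fun y => ?_)
  by_cases h : y ∈ Set.range u
  · obtain ⟨n, rfl⟩ := h
    simp only [mul_apply_eq_comp, partialTranslation_apply]
  · simp only [mul_apply_eq_comp, partialTranslation_apply_of_notMem_range hp hu hu _ h]

theorem hasPropagationLE_partialTranslation [MetricSpace X] {r : ℕ}
    (h : ∀ n, dist (u n) (v n) ≤ r) : HasPropagationLE (partialTranslation (p := p) hp hu hv) r := by
  intro x y hxy
  by_cases hy : y ∈ Set.range v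
  · obtain ⟨n, rfl⟩ := hy
    rw [partialTranslation_apply] at hxy
    by_cases hx : u n = x
    · exact hx ▸ h n
    · exact absurd (delta_apply_ne hx) hxy
  · exact absurd (partialTranslation_apply_of_notMem_range hp hu hv _ hy) hxy

end PartialTranslation

section Spatial

variable {p : ℝ≥0∞} [Fact (1 ≤ p)] {X Y : Type*} [MetricSpace X] [MetricSpace Y]

/-- An operator `q ≠ 0` such that `q a q` is a multiple of `q` for every `a` in the uniform Roe
algebra has rank one. -/
theorem exists_apply_eq_smul_of_corner (hp : p ≠ ∞) {q : EllP p X →L[ℂ] EllP p X} (hq0 : q ≠ 0)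
    (hcorner : ∀ a ∈ uniformRoeAlgebra p X hp, ∃ c : ℂ, q * a * q = c • q) :
    ∃ v : EllP p X, v ≠ 0 ∧ (∃ w, v = q w) ∧ ∀ η, ∃ c : ℂ, q η = c • v := by
  obtain ⟨w, hw⟩ := exists_apply_delta_ne_zero hp hq0
  refine ⟨q (delta p w), hw, ⟨_, rfl⟩, fun η => ?_⟩
  by_cases hη : q η = 0
  · exact ⟨0, by rw [hη, zero_smul]⟩
  obtain ⟨z, hz⟩ := exists_apply_ne_zero hη
  obtain ⟨c, hc⟩ := hcorner _ (matrixUnit_mem_uniformRoeAlgebra hp z w)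
  have h := congrArg (fun T => T η) hc
  simp only [mul_apply_eq_comp, matrixUnit_apply, map_smul,
    smul_apply] at h
  have hc0 : c ≠ 0 := by
    rintro rfl
    rw [zero_smul, smul_eq_zero] at h
    exact h.elim hz hw
  exact ⟨c⁻¹ * (q η) z, by rw [mul_smul, h, smul_smul, inv_mul_cancel₀ hc0, one_smul]⟩

/-- Every isomorphism between uniform Roe algebras is spatially implemented. -/
theorem exists_continuousLinearEquiv_intertwining (hp : p ≠ ∞) [Nonempty X]
    (Φ : uniformRoeAlgebra p X hp ≃A[ℂ] uniformRoeAlgebra p Y hp) :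
    ∃ U : EllP p X ≃L[ℂ] EllP p Y, ∀ (a : uniformRoeAlgebra p X hp) (ξ : EllP p X),
      (Φ a : EllP p Y →L[ℂ] EllP p Y) (U ξ) = U ((a : EllP p X →L[ℂ] EllP p X) ξ) := by
  obtain ⟨x₀⟩ := ‹Nonempty X›
  let R : EllP p X → uniformRoeAlgebra p X hp := fun ξ =>
    ⟨rankOne x₀ ξ, rankOne_mem_uniformRoeAlgebra hp x₀ ξ⟩
  have hRinj : ∀ ξ, R ξ = 0 → ξ = 0 := fun ξ h => by
    have := congrArg (fun T : uniformRoeAlgebra p X hp =>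
      (T : EllP p X →L[ℂ] EllP p X) (delta p x₀)) h
    simpa [R, rankOne_apply_delta] using this
  have hRmul : ∀ (a : uniformRoeAlgebra p X hp) ξ,
      R ((a : EllP p X →L[ℂ] EllP p X) ξ) = a * R ξ := fun a ξ => by
    refine Subtype.ext (ContinuousLinearMap.ext fun η => ?_)
    simp [R, rankOne_apply]
  let e := R (delta p x₀)
  have hRe : ∀ a : uniformRoeAlgebra p X hp,
      a * e = R ((a : EllP p X →L[ℂ] EllP p X) (delta p x₀)) := fun a => (hRmul a _).symm
  have hRe' : ∀ ξ, R ξ * e = R ξ := fun ξ => by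
    rw [hRe]
    simp only [R, rankOne_apply_delta]
  let q := Φ e
  have hq0 : (q : EllP p Y →L[ℂ] EllP p Y) ≠ 0 := by
    intro h
    have h1 : e = 0 := by
      apply Φ.injective
      rw [map_zero]
      exact Subtype.ext h
    have h2 := congrArg (fun ξ : EllP p X => ξ x₀) (hRinj _ h1)
    simp [delta_apply_self] at h2
  have hcorner : ∀ b ∈ uniformRoeAlgebra p Y hp, ∃ c : ℂ,
      (q : EllP p Y →L[ℂ] EllP p Y) * b * q = c • (q : EllP p Y →L[ℂ] EllP p Y) := by
    intro b hb
    obtain ⟨a, ha⟩ := Φ.surjective ⟨b, hb⟩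
    refine ⟨(a : EllP p X →L[ℂ] EllP p X) (delta p x₀) x₀, ?_⟩
    have h1 : e * a * e = (a : EllP p X →L[ℂ] EllP p X) (delta p x₀) x₀ • e := by
      rw [mul_assoc, hRe]
      refine Subtype.ext (ContinuousLinearMap.ext fun η => ?_)
      simp [R, e, rankOne_apply, smul_smul, mul_comm]
    have h2 := congrArg (fun T => ((Φ T : uniformRoeAlgebra p Y hp) :
      EllP p Y →L[ℂ] EllP p Y)) h1
    simpa [map_mul, map_smul, ha] using h2
  obtain ⟨v, hv0, ⟨w, hw⟩, hv⟩ := exists_apply_eq_smul_of_corner hp hq0 hcorner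
  have hqv : (q : EllP p Y →L[ℂ] EllP p Y) v = v := by
    have : q * q = q := by rw [← map_mul, hRe']
    rw [hw, ← mul_apply_eq_comp]
    exact congrArg (fun T : uniformRoeAlgebra p Y hp => (T : EllP p Y →L[ℂ] EllP p Y) w) this
  let U : EllP p X →L[ℂ] EllP p Y :=
    { toFun := fun ξ => (Φ (R ξ) : EllP p Y →L[ℂ] EllP p Y) v
      map_add' := fun ξ η => by
        have : R (ξ + η) = R ξ + R η :=
          Subtype.ext (ContinuousLinearMap.ext fun ζ => by simp [R, rankOne_apply])
        rw [this, map_add]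
        rfl
      map_smul' := fun c ξ => by
        have : R (c • ξ) = c • R ξ :=
          Subtype.ext (ContinuousLinearMap.ext fun ζ => by
            simp [R, rankOne_apply, smul_smul, mul_comm])
        rw [this, map_smul]
        rfl
      cont := by
        have hR : Continuous R := (continuous_rankOne x₀).subtype_mk _
        exact (ContinuousLinearMap.apply ℂ (EllP p Y) v).continuous.comp
          (continuous_subtype_val.comp (Φ.continuous_toFun.comp hR)) }
  have hU : ∀ ξ, U ξ = (Φ (R ξ) : EllP p Y →L[ℂ] EllP p Y) v := fun _ => rfl
  have hker : (U : EllP p X →ₗ[ℂ] EllP p Y).ker = ⊥ := by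
    refine LinearMap.ker_eq_bot'.2 fun ξ hξ => hRinj ξ (Φ.injective ?_)
    rw [← hRe', map_mul, map_zero]
    refine Subtype.ext (ContinuousLinearMap.ext fun η => ?_)
    obtain ⟨c, hc⟩ := hv η
    have hξ' : (Φ (R ξ) : EllP p Y →L[ℂ] EllP p Y) v = 0 := hξ
    change (Φ (R ξ) : EllP p Y →L[ℂ] EllP p Y) ((q : EllP p Y →L[ℂ] EllP p Y) η) = 0
    rw [hc, map_smul, hξ', smul_zero]
  have hrange : (U : EllP p X →ₗ[ℂ] EllP p Y).range = ⊤ := by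
    refine LinearMap.range_eq_top.2 fun η => ?_
    obtain ⟨y, hy⟩ := exists_apply_ne_zero hv0
    let b : uniformRoeAlgebra p Y hp :=
      ⟨rankOne y ((v y)⁻¹ • η), rankOne_mem_uniformRoeAlgebra hp y _⟩
    obtain ⟨a, ha⟩ := Φ.surjective b
    refine ⟨(a : EllP p X →L[ℂ] EllP p X) (delta p x₀), ?_⟩
    change (Φ (R _) : EllP p Y →L[ℂ] EllP p Y) v = η
    rw [← hRe, map_mul, ha]
    change (b : EllP p Y →L[ℂ] EllP p Y) ((q : EllP p Y →L[ℂ] EllP p Y) v) = η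
    rw [hqv]
    simp only [b, rankOne_apply]
    rw [smul_smul, mul_inv_cancel₀ hy, one_smul]
  refine ⟨ContinuousLinearEquiv.ofBijective U hker hrange, fun a ξ => ?_⟩
  change (Φ a : EllP p Y →L[ℂ] EllP p Y) (U ξ) = U ((a : EllP p X →L[ℂ] EllP p X) ξ)
  rw [hU, hU, hRmul, map_mul]
  rfl

end Spatial

section Matrix

open Filter

/-- A summable family that is dominated by a geometric one away from the index `n` has a sum close
to its `n`-th term. -/
theorem HasSum.norm_sub_apply_le_of_geometric {a : ℕ → ℂ} {S : ℂ} (h : HasSum a S) {C : ℝ}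
    (hC : 0 ≤ C) (n : ℕ) (hle : ∀ m, m ≠ n → ‖a m‖ ≤ C * (1 / 2) ^ m) : ‖S - a n‖ ≤ C * 2 := by
  have h1 := hasSum_ite_sub_hasSum h n
  rw [← h1.tsum_eq]
  refine tsum_of_norm_bounded (hasSum_geometric_two.mul_left C) fun m => ?_
  split_ifs with hm
  · rw [norm_zero]
    positivity
  · exact hle m hm

variable {p : ℝ≥0∞} [Fact (1 ≤ p)] {X Y : Type*}

theorem ContinuousLinearEquiv.norm_apply_delta_le (U : EllP p X ≃L[ℂ] EllP p Y) (x : X) (y : Y) :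
    ‖U (delta p x) y‖ ≤ ‖(U : EllP p X →L[ℂ] EllP p Y)‖ := by
  refine (norm_apply_le _ y).trans ?_
  have := (U : EllP p X →L[ℂ] EllP p Y).le_opNorm (delta p x)
  rwa [norm_delta, mul_one] at this

theorem one_le_norm_delta_sub {x y : X} (h : x ≠ y) : 1 ≤ ‖delta p x - delta p y‖ := by
  have h1 := norm_apply_le (delta p x - delta p y) x
  have h2 : (delta p x - delta p y) x = 1 := by
    rw [lp.coeFn_sub, Pi.sub_apply, delta_apply_self, delta_apply_ne h, sub_zero]
  rwa [h2, norm_one] at h1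

/-- The modulus of the matrix coefficient of the rank one operator `U e_{xx'} U⁻¹` in the row `y`
and the column `z`. -/
noncomputable def conjEntry (U : EllP p X ≃L[ℂ] EllP p Y) (x x' : X) (y z : Y) : ℝ :=
  ‖U.symm (delta p z) x‖ * ‖U (delta p x') y‖

theorem exists_conjEntry_pos (hp : p ≠ ∞) (U : EllP p X ≃L[ℂ] EllP p Y) (x : X) :
    ∃ y z, 0 < conjEntry U x x y z := by
  have hx : delta p x ≠ 0 := by
    rw [← norm_ne_zero_iff, norm_delta]
    exact one_ne_zero
  obtain ⟨y, hy⟩ := exists_apply_ne_zero (U.map_ne_zero_iff.2 hx)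
  obtain ⟨z, hz⟩ : ∃ z, U.symm (delta p z) x ≠ 0 := by
    by_contra! h
    have h1 := (hasSum_smul_delta hp (U (delta p x))).mapL
      ((lp.evalCLM ℂ (fun _ : X => ℂ) p x).comp (U.symm : EllP p Y →L[ℂ] EllP p X))
    have h2 : ∀ z, ((lp.evalCLM ℂ (fun _ : X => ℂ) p x).comp
        (U.symm : EllP p Y →L[ℂ] EllP p X)) (U (delta p x) z • delta p z) = 0 := fun z => by
      rw [map_smul]
      exact smul_eq_zero_of_right _ (h z)
    simp only [h2] at h1
    have h3 := h1.unique hasSum_zero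
    have h4 : U.symm (U (delta p x)) x = 0 := h3
    rw [U.symm_apply_apply, delta_apply_self] at h4
    exact one_ne_zero h4
  exact ⟨y, z, mul_pos (norm_pos_iff.2 hz) (norm_pos_iff.2 hy)⟩

theorem hasSum_conj_partialTranslation (hp : p ≠ ∞) {U : EllP p X ≃L[ℂ] EllP p Y} {u v : ℕ → X}
    (hu : u.Injective) (hv : v.Injective) {b : EllP p Y →L[ℂ] EllP p Y}
    (hb : ∀ ξ, b (U ξ) = U (partialTranslation hp hu hv ξ)) (y z : Y) :
    HasSum (fun n => U.symm (delta p z) (u n) * U (delta p (v n)) y) (b (delta p z) y) := by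
  have h := (hasSum_partialTranslation hp hu hv (U.symm (delta p z))).mapL
    ((lp.evalCLM ℂ (fun _ : Y => ℂ) p y).comp (U : EllP p X →L[ℂ] EllP p Y))
  have h1 : ((lp.evalCLM ℂ (fun _ : Y => ℂ) p y).comp (U : EllP p X →L[ℂ] EllP p Y))
      (partialTranslation hp hu hv (U.symm (delta p z))) = b (delta p z) y := by
    change U (partialTranslation hp hu hv (U.symm (delta p z))) y = _
    rw [← hb, U.apply_symm_apply]
  rw [h1] at h
  simp only [map_smul] at h
  exact h

variable [MetricSpace X] [MetricSpace Y]

/-- Conjugation by `U` maps the uniform Roe algebra of `X` into that of `Y`. -/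
def ConjMapsRoe (hp : p ≠ ∞) (U : EllP p X ≃L[ℂ] EllP p Y) : Prop :=
  ∀ a ∈ uniformRoeAlgebra p X hp, ∃ b ∈ uniformRoeAlgebra p Y hp, ∀ ξ, b (U ξ) = U (a ξ)

theorem eventually_dist_le_of_le_conjEntry {hp : p ≠ ∞} {U : EllP p X ≃L[ℂ] EllP p Y}
    (hU : ConjMapsRoe hp U) (x x' : X) {ε : ℝ} (hε : 0 < ε) :
    ∀ᶠ n : ℕ in atTop, ∀ y z, ε ≤ conjEntry U x x' y z → dist z y ≤ n := by
  obtain ⟨b, hb, hbU⟩ := hU _ (matrixUnit_mem_uniformRoeAlgebra hp x x')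
  obtain ⟨n, hn⟩ := exists_dist_le_of_le_norm_apply_delta hb hε
  filter_upwards [eventually_ge_atTop n] with m hm y z h
  refine (hn z y ?_).trans (Nat.cast_le.2 hm)
  have h1 := hbU (U.symm (delta p z))
  rw [U.apply_symm_apply, matrixUnit_apply, map_smul] at h1
  rw [h1, lp.coeFn_smul, Pi.smul_apply, norm_smul]
  exact h

theorem UniformlyLocallyFinite.finite_setOf_dist_le (hX : UniformlyLocallyFinite X) (r : ℕ)
    (x : X) : {y | dist x y ≤ r}.Finite := by
  obtain ⟨N, hN⟩ := hX r
  exact Set.finite_of_encard_le_coe (hN x)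

/-- There are only finitely many pairs of points at distance at most `r` one of which is in a given
finite set. -/
theorem UniformlyLocallyFinite.finite_setOf_pairs (hX : UniformlyLocallyFinite X) (r : ℕ)
    {F : Set X} (hF : F.Finite) : {w : X × X | (w.1 ∈ F ∨ w.2 ∈ F) ∧ dist w.1 w.2 ≤ r}.Finite := by
  have hG : (F ∪ ⋃ x ∈ F, {y | dist x y ≤ r}).Finite :=
    hF.union (hF.biUnion fun x _ => hX.finite_setOf_dist_le r x)
  refine (hG.prod hG).subset ?_
  rintro ⟨x, x'⟩ ⟨h | h, hd⟩
  · exact ⟨Or.inl h, Or.inr (Set.mem_biUnion h hd)⟩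
  · exact ⟨Or.inr (Set.mem_biUnion h (by simpa [dist_comm] using hd)), Or.inl h⟩

/-- The operators `U e_{xx'} U⁻¹` with `dist x x' ≤ r` have entries that vanish far away from the
diagonal, uniformly in `x` and `x'`. -/
theorem exists_forall_dist_le_of_le_conjEntry {hp : p ≠ ∞} {U : EllP p X ≃L[ℂ] EllP p Y}
    (hX : UniformlyLocallyFinite X) (hU : ConjMapsRoe hp U) (r : ℕ) {ε : ℝ} (hε : 0 < ε) :
    ∃ s : ℕ, ∀ x x' y z, dist x x' ≤ r → ε ≤ conjEntry U x x' y z → dist z y ≤ s := by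
  by_contra! h
  obtain ⟨f, hfP, hfr⟩ := exists_seq_of_forall_finset_exists
    (α := ℕ × (X × X) × (Y × Y))
    (fun t => dist t.2.1.1 t.2.1.2 ≤ r ∧ ε ≤ conjEntry U t.2.1.1 t.2.1.2 t.2.2.1 t.2.2.2 ∧
      (t.1 : ℝ) ≤ dist t.2.2.2 t.2.2.1)
    (fun t t' => t.1 < t'.1 ∧ t.2.1.1 ≠ t'.2.1.1 ∧ t.2.1.2 ≠ t'.2.1.2 ∧
      conjEntry U t.2.1.1 t.2.1.2 t'.2.2.1 t'.2.2.2 ≤ ε / 4 * (1 / 2) ^ t.1 ∧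
      conjEntry U t'.2.1.1 t'.2.1.2 t.2.2.1 t.2.2.2 ≤ ε / 4 * (1 / 2) ^ t'.1) (by
    intro S _
    obtain ⟨K, hK⟩ : ∃ K : ℕ, ∀ t ∈ S, t.1 < K :=
      ((Filter.eventually_all_finset S).2 fun t _ => eventually_gt_atTop t.1).exists
    set M := ‖(U : EllP p X →L[ℂ] EllP p Y)‖
    have hM : 0 ≤ M := norm_nonneg _
    set η : ℝ := ε / 4 * (1 / 2) ^ K / (M + 1)
    have hη : 0 < η := by positivity
    set F : Set X := ⋃ t ∈ S, ({t.2.1.1, t.2.1.2} ∪ {x | η ≤ ‖U.symm (delta p t.2.2.2) x‖})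
    have hF : F.Finite := S.finite_toSet.biUnion fun t _ =>
      (Set.toFinite _).union (finite_setOf_le_norm_apply hp _ hη)
    have h1 := (Filter.eventually_all_finite (hX.finite_setOf_pairs r hF)).2 fun w _ =>
      eventually_dist_le_of_le_conjEntry hU w.1 w.2 hε
    have h2 := (Filter.eventually_all_finset S).2 fun t _ =>
      eventually_dist_le_of_le_conjEntry hU t.2.1.1 t.2.1.2
        (show 0 < ε / 4 * (1 / 2) ^ t.1 by positivity)
    obtain ⟨D, hD1, hD2, hD3⟩ := (h1.and (h2.and (eventually_ge_atTop K))).exists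
    obtain ⟨x, x', y, z, hr, he, hd⟩ := h D
    have hxF : ¬(x ∈ F ∨ x' ∈ F) := fun hx => absurd (hD1 (x, x') ⟨hx, hr⟩ y z he) hd.not_ge
    push Not at hxF
    have hmem : ∀ t ∈ S, ∀ w ∉ F, w ≠ t.2.1.1 ∧ w ≠ t.2.1.2 ∧
        ‖U.symm (delta p t.2.2.2) w‖ < η := fun t ht w hw => by
      have hw' : w ∉ ({t.2.1.1, t.2.1.2} ∪ {x | η ≤ ‖U.symm (delta p t.2.2.2) x‖} : Set X) :=
        fun h' => hw (Set.mem_biUnion ht h')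
      simp only [Set.mem_union, Set.mem_insert_iff, Set.mem_singleton_iff, Set.mem_ofPred_eq,
        not_or, not_le] at hw'
      exact ⟨hw'.1.1, hw'.1.2, hw'.2⟩
    refine ⟨(K, (x, x'), (y, z)), ⟨hr, he, (Nat.cast_le.2 hD3).trans hd.le⟩, fun t ht =>
      ⟨hK t ht, (hmem t ht x hxF.1).1.symm, (hmem t ht x' hxF.2).2.1.symm, ?_, ?_⟩⟩
    · by_contra! hlt
      exact absurd (hD2 t ht y z hlt.le) hd.not_ge
    · have hle : conjEntry U x x' t.2.2.1 t.2.2.2 ≤ η * (M + 1) :=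
        mul_le_mul (hmem t ht x hxF.1).2.2.le
          ((U.norm_apply_delta_le x' _).trans (by linarith)) (norm_nonneg _) hη.le
      rwa [div_mul_cancel₀ _ (by positivity)] at hle)
  have hu : Function.Injective fun n => (f n).2.1.1 :=
    Function.Injective.of_lt_imp_ne fun m n hmn => (hfr m n hmn).2.1
  have hv : Function.Injective fun n => (f n).2.1.2 :=
    Function.Injective.of_lt_imp_ne fun m n hmn => (hfr m n hmn).2.2.1
  have hk : StrictMono fun n => (f n).1 := fun m n hmn => (hfr m n hmn).1
  have hpow : ∀ m, (1 / 2 : ℝ) ^ (f m).1 ≤ (1 / 2) ^ m := fun m =>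
    pow_le_pow_of_le_one (by norm_num) (by norm_num) (hk.le_apply (x := m))
  obtain ⟨b, hb, hbU⟩ := hU _ (HasPropagationLE.mem_uniformRoeAlgebra hp
    (hasPropagationLE_partialTranslation hp hu hv fun n => (hfP n).1))
  obtain ⟨N, hN⟩ := exists_dist_le_of_le_norm_apply_delta hb (half_pos hε)
  have key : ε / 2 ≤ ‖b (delta p (f (N + 1)).2.2.2) (f (N + 1)).2.2.1‖ := by
    have h1 := (hasSum_conj_partialTranslation hp hu hv hbU (f (N + 1)).2.2.1
      (f (N + 1)).2.2.2).norm_sub_apply_le_of_geometric (C := ε / 4) (by positivity) (N + 1)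
      fun m hm => by
        rw [norm_mul]
        refine le_trans ?_ (mul_le_mul_of_nonneg_left (hpow m) (by positivity))
        rcases hm.lt_or_gt with hm | hm
        · exact (hfr m (N + 1) hm).2.2.2.1
        · exact (hfr (N + 1) m hm).2.2.2.2
    have h2 := (hfP (N + 1)).2.1
    rw [conjEntry, ← norm_mul] at h2
    have h3 := norm_sub_norm_le (U.symm (delta p (f (N + 1)).2.2.2) (f (N + 1)).2.1.1 *
      U (delta p (f (N + 1)).2.1.2) (f (N + 1)).2.2.1)
      (b (delta p (f (N + 1)).2.2.2) (f (N + 1)).2.2.1)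
    rw [norm_sub_rev] at h3
    linarith
  have h1 := hN _ _ key
  have h2 : ((N + 1 : ℕ) : ℝ) ≤ (f (N + 1)).1 := Nat.cast_le.2 (hk.le_apply (x := N + 1))
  have h3 := (hfP (N + 1)).2.2
  push_cast at h2
  linarith

end Matrix

section Ghost

open Filter

variable {p : ℝ≥0∞} [Fact (1 ≤ p)] {X Y : Type*}

/-- An operator that fixes infinitely many vectors `U δ_{u n}` is not compact. -/
theorem not_isCompactOperator_of_apply_delta {U : EllP p X ≃L[ℂ] EllP p Y} {u : ℕ → X}
    (hu : u.Injective) {b : EllP p Y →L[ℂ] EllP p Y}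
    (hb : ∀ n, b (U (delta p (u n))) = U (delta p (u n))) : ¬IsCompactOperator b := by
  intro hc
  obtain ⟨K, hK, hbK⟩ := IsCompactOperator.image_closedBall_subset_compact
    (f := (b : EllP p Y →ₗ[ℂ] EllP p Y)) hc ‖(U : EllP p X →L[ℂ] EllP p Y)‖
  have hmem : ∀ n, U (delta p (u n)) ∈ K := fun n => by
    refine hbK ⟨U (delta p (u n)), ?_, hb n⟩
    have := (U : EllP p X →L[ℂ] EllP p Y).le_opNorm (delta p (u n))
    rw [norm_delta, mul_one] at this
    simpa using this
  obtain ⟨a, -, φ, hφ, ha⟩ := hK.tendsto_subseq hmem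
  have h1 := (U.symm.continuous.tendsto a).comp ha
  obtain ⟨N, hN⟩ := Metric.cauchySeq_iff.1 h1.cauchySeq 1 one_pos
  have h2 := hN N le_rfl (N + 1) N.le_succ
  simp only [Function.comp_apply, U.symm_apply_apply, dist_eq_norm] at h2
  exact h2.not_ge (one_le_norm_delta_sub (hu.ne (hφ N.lt_succ_self).ne))

/-- If the entries of `U e_{u n, u n} U⁻¹` are summable uniformly, then the operator
`U χ U⁻¹`, where `χ` is the projection onto the range of `u`, is a ghost. -/
theorem isGhost_conj_partialTranslation (hp : p ≠ ∞) {U : EllP p X ≃L[ℂ] EllP p Y} {u : ℕ → X}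
    (hu : u.Injective) {b : EllP p Y →L[ℂ] EllP p Y}
    (hb : ∀ ξ, b (U ξ) = U (partialTranslation hp hu hu ξ))
    (hle : ∀ n y z, conjEntry U (u n) (u n) y z ≤ (1 / 2) ^ n) : IsGhost b := by
  have hlim : Tendsto (fun w : Y × Y => b (delta p w.2) w.1) (comap Prod.fst cofinite)
      (nhds (∑' _ : ℕ, (0 : ℂ))) := by
    have : (fun w : Y × Y => b (delta p w.2) w.1) = fun w : Y × Y =>
        ∑' n, U.symm (delta p w.2) (u n) * U (delta p (u n)) w.1 :=
      funext fun w => (hasSum_conj_partialTranslation hp hu hu hb w.1 w.2).tsum_eq.symm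
    rw [this]
    refine tendsto_tsum_of_dominated_convergence (bound := fun n : ℕ => (1 / 2 : ℝ) ^ n)
      summable_geometric_two (fun n => ?_) (Eventually.of_forall fun w n => ?_)
    · have h1 := (hasSum_smul_delta hp (U (delta p (u n)))).summable.tendsto_cofinite_zero.norm
      simp only [norm_smul, norm_delta, mul_one, norm_zero] at h1
      have h2 := (h1.comp (tendsto_comap (f := (Prod.fst : Y × Y → Y)))).const_mul
        ‖(U.symm : EllP p Y →L[ℂ] EllP p X)‖
      rw [mul_zero] at h2
      refine squeeze_zero_norm (fun w => ?_) h2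
      rw [norm_mul]
      exact mul_le_mul_of_nonneg_right (U.symm.norm_apply_delta_le _ _) (norm_nonneg _)
    · rw [norm_mul]
      exact hle n w.1 w.2
  rw [tsum_zero] at hlim
  intro ε hε
  have h1 := (hlim.norm.eventually (gt_mem_nhds (by rwa [norm_zero])))
  rw [eventually_comap, eventually_cofinite] at h1
  refine ⟨h1.toFinset, fun x y _ hy => ?_⟩
  rw [norm_corner]
  by_contra h2
  exact hy (h1.mem_toFinset.2 fun h3 => h2 (h3 (y, x) rfl))

variable [MetricSpace X] [MetricSpace Y]

/-- If the ghost idempotents are compact, then the entries of `U e_{xx} U⁻¹` are uniformly bounded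
away from zero. -/
theorem exists_forall_le_conjEntry {hp : p ≠ ∞} {U : EllP p X ≃L[ℂ] EllP p Y}
    (hg : GhostIdempotentsCompact p Y hp) (hU : ConjMapsRoe hp U) :
    ∃ δ : ℝ, 0 < δ ∧ ∀ x, ∃ y z, δ ≤ conjEntry U x x y z := by
  by_contra! h
  obtain ⟨f, hfP, hfr⟩ := exists_seq_of_forall_finset_exists (α := ℕ × X)
    (fun t => ∀ y z, conjEntry U t.2 t.2 y z ≤ (1 / 2) ^ t.1)
    (fun t t' => t.1 < t'.1 ∧ t.2 ≠ t'.2) (by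
    intro S _
    have h1 : ∀ x, ∀ᶠ k : ℕ in atTop, ∃ y z, (1 / 2 : ℝ) ^ k < conjEntry U x x y z := fun x => by
      obtain ⟨y, z, hyz⟩ := exists_conjEntry_pos hp U x
      have := (tendsto_pow_atTop_nhds_zero_of_lt_one (r := (1 / 2 : ℝ)) (by norm_num)
        (by norm_num)).eventually (gt_mem_nhds hyz)
      exact this.mono fun k hk => ⟨y, z, hk⟩
    obtain ⟨K, hK⟩ := ((Filter.eventually_all_finset S).2 fun t _ =>
      (h1 t.2).and (eventually_gt_atTop t.1)).exists
    obtain ⟨x, hx⟩ := h ((1 / 2) ^ K) (by positivity)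
    refine ⟨(K, x), fun y z => (hx y z).le, fun t ht => ⟨(hK t ht).2, ?_⟩⟩
    rintro rfl
    obtain ⟨y, z, hyz⟩ := (hK t ht).1
    exact (hx y z).not_gt hyz)
  have hu : Function.Injective fun n => (f n).2 :=
    Function.Injective.of_lt_imp_ne fun m n hmn => (hfr m n hmn).2
  have hk : StrictMono fun n => (f n).1 := fun m n hmn => (hfr m n hmn).1
  obtain ⟨b, hb, hbU⟩ := hU _ (HasPropagationLE.mem_uniformRoeAlgebra hp
    (hasPropagationLE_partialTranslation (r := 0) hp hu hu fun n => by simp))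
  refine not_isCompactOperator_of_apply_delta (U := U) (b := b) hu (fun n => ?_) (hg b hb ?_ ?_)
  · rw [hbU]
    exact congrArg U (partialTranslation_apply_delta hp hu hu n)
  · refine ContinuousLinearMap.ext fun η => ?_
    obtain ⟨ξ, rfl⟩ := U.surjective η
    rw [mul_apply_eq_comp, hbU, hbU, ← mul_apply_eq_comp,
      (isIdempotentElem_partialTranslation hp hu).eq]
  · exact isGhost_conj_partialTranslation hp hu hbU fun n y z => (hfP n y z).trans
      (pow_le_pow_of_le_one (by norm_num) (by norm_num) (hk.le_apply (x := n)))

/-- If the ghost idempotents are compact, then the columns of `U` and the rows of `U⁻¹` have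
entries that are uniformly bounded away from zero. -/
theorem exists_forall_le_norm_apply_delta {hp : p ≠ ∞} {U : EllP p X ≃L[ℂ] EllP p Y}
    (hg : GhostIdempotentsCompact p Y hp) (hU : ConjMapsRoe hp U) :
    ∃ δ : ℝ, 0 < δ ∧ ∀ x, ∃ y z, δ ≤ ‖U (delta p x) y‖ ∧ δ ≤ ‖U.symm (delta p z) x‖ := by
  obtain ⟨δ, hδ, h⟩ := exists_forall_le_conjEntry hg hU
  set M := ‖(U : EllP p X →L[ℂ] EllP p Y)‖
  set M' := ‖(U.symm : EllP p Y →L[ℂ] EllP p X)‖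
  have hM : 0 ≤ M := norm_nonneg _
  have hM' : 0 ≤ M' := norm_nonneg _
  refine ⟨δ / (M + M' + 1), by positivity, fun x => ?_⟩
  obtain ⟨y, z, hyz⟩ := h x
  have h1 : ‖U (delta p x) y‖ ≤ M := U.norm_apply_delta_le x y
  have h2 : ‖U.symm (delta p z) x‖ ≤ M' := U.symm.norm_apply_delta_le z x
  rw [conjEntry] at hyz
  refine ⟨y, z, ?_, ?_⟩ <;> rw [div_le_iff₀ (by positivity)] <;>
    nlinarith [norm_nonneg (U (delta p x) y), norm_nonneg (U.symm (delta p z) x)]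

/-- If the columns of `U` and the rows of `U⁻¹` have large entries, then every map that picks
large entries of the columns of `U` is coarse. -/
theorem isCoarseMap_of_le_norm_apply_delta {hp : p ≠ ∞} {U : EllP p X ≃L[ℂ] EllP p Y}
    (hX : UniformlyLocallyFinite X) (hU : ConjMapsRoe hp U) {δ : ℝ} (hδ : 0 < δ) {f g : X → Y}
    (hf : ∀ x, δ ≤ ‖U (delta p x) (f x)‖) (hg : ∀ x, δ ≤ ‖U.symm (delta p (g x)) x‖) :
    IsCoarseMap f := by
  have hfg : ∀ x x', δ * δ ≤ conjEntry U x x' (f x') (g x) := fun x x' =>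
    mul_le_mul (hg x) (hf x') hδ.le (norm_nonneg _)
  intro r _
  obtain ⟨s, hs⟩ := exists_forall_dist_le_of_le_conjEntry hX hU ⌈r⌉₊ (mul_pos hδ hδ)
  refine ⟨s + s + 1, by positivity, fun x x' hxx' => ?_⟩
  have h1 := hs x x (f x) (g x) (by simp) (hfg x x)
  have h2 := hs x x' (f x') (g x) (hxx'.le.trans (Nat.le_ceil r)) (hfg x x')
  linarith [dist_triangle_left (f x) (f x') (g x)]

/-- Maps that pick large entries of the columns of `U` and of `U⁻¹` are inverse to each other up to
a bounded error. -/
theorem areClose_comp_id_of_le_norm_apply_delta {hp : p ≠ ∞} {U : EllP p X ≃L[ℂ] EllP p Y}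
    (hX : UniformlyLocallyFinite X) (hU : ConjMapsRoe hp U) {δ δ' : ℝ} (hδ : 0 < δ) (hδ' : 0 < δ')
    {f : X → Y} {g : Y → X} (hf : ∀ x, δ ≤ ‖U (delta p x) (f x)‖)
    (hg : ∀ y, δ' ≤ ‖U.symm (delta p y) (g y)‖) : AreClose (f ∘ g) id := by
  obtain ⟨s, hs⟩ := exists_forall_dist_le_of_le_conjEntry hX hU 0 (mul_pos hδ' hδ)
  refine ⟨s, fun y => ?_⟩
  rw [dist_comm]
  exact hs (g y) (g y) (f (g y)) y (by simp)
    (mul_le_mul (hg y) (hf (g y)) hδ.le (norm_nonneg _))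

theorem coarselyEquivalent_of_conjMapsRoe {hp : p ≠ ∞} {U : EllP p X ≃L[ℂ] EllP p Y}
    (hX : UniformlyLocallyFinite X) (hY : UniformlyLocallyFinite Y)
    (hgX : GhostIdempotentsCompact p X hp) (hgY : GhostIdempotentsCompact p Y hp)
    (hU : ConjMapsRoe hp U) (hU' : ConjMapsRoe hp U.symm) : CoarselyEquivalent X Y := by
  obtain ⟨δ, hδ, h⟩ := exists_forall_le_norm_apply_delta hgY hU
  obtain ⟨δ', hδ', h'⟩ := exists_forall_le_norm_apply_delta hgX hU'
  choose f f' hf hf' using h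
  choose g g' hg hg' using h'
  exact ⟨f, g, isCoarseMap_of_le_norm_apply_delta hX hU hδ hf hf',
    isCoarseMap_of_le_norm_apply_delta hY hU' hδ' hg hg',
    areClose_comp_id_of_le_norm_apply_delta hY hU' hδ' hδ hg hf,
    areClose_comp_id_of_le_norm_apply_delta hX hU hδ hδ' hf hg⟩

theorem isEmpty_of_uniformRoeAlgebra_equiv {hp : p ≠ ∞} [IsEmpty X]
    (Φ : uniformRoeAlgebra p X hp ≃A[ℂ] uniformRoeAlgebra p Y hp) : IsEmpty Y := by
  refine ⟨fun y => ?_⟩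
  have h1 : (1 : uniformRoeAlgebra p X hp) = 0 :=
    Subtype.ext (ContinuousLinearMap.ext fun ξ => lp.ext (funext fun x => isEmptyElim x))
  have h2 : (1 : uniformRoeAlgebra p Y hp) = 0 := by
    rw [← map_one Φ, h1, map_zero]
  have h3 := congrArg (fun T : uniformRoeAlgebra p Y hp =>
    ((T : EllP p Y →L[ℂ] EllP p Y) (delta p y)) y) h2
  simp [delta_apply_self] at h3

end Ghost

theorem corollary1p3 (p : ℝ≥0∞) [Fact (1 ≤ p)] (hp : p ≠ ∞)
    (X Y : Type*) [MetricSpace X] [MetricSpace Y]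
    (hX : UniformlyLocallyFinite X) (hY : UniformlyLocallyFinite Y)
    (hgX : GhostIdempotentsCompact p X hp) (hgY : GhostIdempotentsCompact p Y hp)
    (hiso : Nonempty (uniformRoeAlgebra p X hp ≃A[ℂ] uniformRoeAlgebra p Y hp)) :
    CoarselyEquivalent X Y := by
  obtain ⟨Φ⟩ := hiso
  rcases isEmpty_or_nonempty X with hXe | hXn
  · have := isEmpty_of_uniformRoeAlgebra_equiv Φ
    exact ⟨isEmptyElim, isEmptyElim, fun _ _ => ⟨1, one_pos, fun x => isEmptyElim x⟩,
      fun _ _ => ⟨1, one_pos, fun y => isEmptyElim y⟩, ⟨0, fun x => isEmptyElim x⟩,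
      ⟨0, fun y => isEmptyElim y⟩⟩
  obtain ⟨U, hU⟩ := exists_continuousLinearEquiv_intertwining hp Φ
  refine coarselyEquivalent_of_conjMapsRoe (U := U) hX hY hgX hgY
    (fun a ha => ⟨Φ ⟨a, ha⟩, (Φ ⟨a, ha⟩).2, hU ⟨a, ha⟩⟩) fun b hb => ?_
  obtain ⟨a, ha⟩ := Φ.surjective ⟨b, hb⟩
  refine ⟨a, a.2, fun η => ?_⟩
  have h := hU a (U.symm η)
  rw [ha, U.apply_symm_apply] at h
  rw [h, U.symm_apply_apply]
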